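/- Let $n\ge 1$ and let $\mathcal S_n$ be the set of permutations $\pi=\pi_1\pi_2\cdots\pi_n$ of $[n]=\{1,\dots,n\}$. Put \[ \mathrm F(\pi)=\pi_1,\qquad \mathrm E(\pi)=\pi_n,\qquad \mathrm{Des}(\pi)=\{i\in[n-1]:\pi_i>\pi_{i+1}\},\qquad \mathrm{des}(\pi)=\#\mathrm{Des}(\pi),\qquad \mathrm{Id}(\pi)=\mathrm{Des}(\pi^{-1}). \] For a vincular pattern $\tau$ (a pattern in which some adjacent letters are underlined), let $\tau(\pi)$ be the number of occurrences of $\tau$ in $\pi$, that is, of subsequences of $\pi$ that are order-isomorphic to $\tau$ and in which the letters corresponding to underlined adjacent letters of $\tau$ stand in consecutive positions of $\pi$. Define \[ \mathrm{STAT}=\underline{21}+\underline{13}2+\underline{21}3+\underline{32}1,\qquad \mathrm{BAST}=\underline{21}+2\underline{13}+1\underline{32}+3\underline{21} \] (here $2\underline{13}$, $1\underline{32}$ and $3\underline{21}$ are patterns of length three, not multiples). Then, for every $n\ge 1$, the $6$-tuples of statistics $(\mathrm F,\mathrm E,\mathrm{des},\mathrm{Id},\mathrm{STAT},\mathrm{BAST})$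 and $(\mathrm F,\mathrm E,\mathrm{des},\mathrm{Id},\mathrm{BAST},\mathrm{STAT})$ have the same joint distribution on $\mathcal S_n$: for all integers $f,e,d,s,t\ge 0$ and every finite set $I$ of non-negative integers, the number of $\pi\in\mathcal S_n$ at which the first tuple equals $(f,e,d,I,s,t)$ is equal to the number of $\pi\in\mathcal S_n$ at which the second tuple equals $(f,e,d,I,s,t)$. -/

import Mathlib

namespace PermStat

/- A permutation `π` of `[n]` is a term of `Equiv.Perm (Fin n)`, read as the word
`π_1 π_2 ⋯ π_n` with `π_{i+1} = π i + 1` for `i : Fin n`. -/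

/-- The first letter `π_1`. -/
def F {n : ℕ} (hn : 1 ≤ n) (π : Equiv.Perm (Fin n)) : ℕ :=
  (π ⟨0, by omega⟩ : ℕ) + 1

/-- The ending letter `π_n`. -/
def E {n : ℕ} (hn : 1 ≤ n) (π : Equiv.Perm (Fin n)) : ℕ :=
  (π ⟨n - 1, by omega⟩ : ℕ) + 1

/-- The descent set `{i ∈ [n-1] : π_i > π_{i+1}}`, with positions counted from `1`. -/
def Des {n : ℕ} (π : Equiv.Perm (Fin n)) : Finset ℕ :=
  (Finset.univ.filter fun i : Fin n => ∃ j : Fin n, (j : ℕ) = i + 1 ∧ π j < π i).image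
    fun i : Fin n => (i : ℕ) + 1

/-- The number of descents. -/
def des {n : ℕ} (π : Equiv.Perm (Fin n)) : ℕ := (Des π).card

/-- The inverse descent set `Des(π⁻¹)`. -/
def IDes {n : ℕ} (π : Equiv.Perm (Fin n)) : Finset ℕ := Des π⁻¹

/-- The number of occurrences in `π` of the vincular pattern with underlying word `τ`, in which,
for every `a ∈ A`, the letters in places `a` and `a + 1` of the pattern (places counted from `0`)
are tied together. An occurrence is an increasing choice `f` of positions of `π` whose letters are
order-isomorphic to `τ`, with tied places sent to consecutive positions. -/
def vincular {k n : ℕ} (τ : Fin k → ℕ) (A : Finset (Fin k)) (π : Equiv.Perm (Fin n)) : ℕ :=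
  (Finset.univ.filter fun f : Fin k → Fin n =>
    (∀ a b : Fin k, a < b → f a < f b) ∧
    (∀ a b : Fin k, π (f a) < π (f b) ↔ τ a < τ b) ∧
    (∀ a b : Fin k, a ∈ A → (b : ℕ) = a + 1 → (f b : ℕ) = f a + 1)).card

/-- `STAT = (21) + (13)2 + (21)3 + (32)1`, tied letters in parentheses. -/
def STAT {n : ℕ} (π : Equiv.Perm (Fin n)) : ℕ :=
  vincular ![2, 1] {0} π + vincular ![1, 3, 2] {0} π + vincular ![2, 1, 3] {0} π +
    vincular ![3, 2, 1] {0} π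

/-- `BAST = (21) + 2(13) + 1(32) + 3(21)`, tied letters in parentheses. -/
def BAST {n : ℕ} (π : Equiv.Perm (Fin n)) : ℕ :=
  vincular ![2, 1] {0} π + vincular ![2, 1, 3] {1} π + vincular ![1, 3, 2] {1} π +
    vincular ![3, 2, 1] {1} π

end PermStat

/-! Count letters from 0 and put n = N + 1. The three-letter patterns of either statistic compare a
letter with a pair of adjacent letters and form one cyclic class, so their indicators telescope.
This gives `BAST_eq` and `STAT_eq`: BAST = des + maj - (N - e) and STAT = (N + 2) des - maj - f,
with f and e the first and last letter. For fixed f, e and des = d, exchanging STAT and BAST is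
therefore the reflection of maj in (N + 1) d + (N - f - e) - maj.

That maj has this symmetry also when the inverse descent set is fixed is shown with P-partitions.
Each function g on the letters is sorted by exactly one permutation, by decreasing value and then by
increasing letter. Bounding the inverse descent set restricts the ascents of g, and prescribing f
and e locates its first maximum and its last minimum. The functions so restricted lie between two
bounds and have a symmetric sum (`sum_arrays_reflect`). Grouped by sorting permutation, their sums
are maj plus the sum of a weakly decreasing sequence, whose distribution is symmetric too. Induction
on d removes the permutations with fewer descents (`sum_permsWith_reflect`), and induction on I
passes from containment in I to equality (`sum_IDes_eq_reflect`).

Equality of distributions is expressed by summing an arbitrary test function φ. -/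

namespace PermStat

open Finset

/-! ### Descents and the major index. -/

/-- The indicator of a descent of `π` between the positions `i` and `i + 1`. -/
def descInd {N : ℕ} (π : Equiv.Perm (Fin (N + 1))) (i : Fin N) : ℕ :=
  if π i.succ < π i.castSucc then 1 else 0

/-- The major index, the sum of the (one-based) positions of the descents. -/
def maj {N : ℕ} (π : Equiv.Perm (Fin (N + 1))) : ℕ := ∑ i : Fin N, ((i : ℕ) + 1) * descInd π i

lemma Des_eq_image {N : ℕ} (π : Equiv.Perm (Fin (N + 1))) :
    Des π = (univ.filter fun i : Fin N => π i.succ < π i.castSucc).image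
      fun i : Fin N => (i : ℕ) + 1 := by
  ext a
  simp only [Des, mem_image, mem_filter, mem_univ, true_and]
  constructor
  · rintro ⟨i, ⟨j, hj, hlt⟩, rfl⟩
    have hi : (i : ℕ) < N := by omega
    refine ⟨⟨i, hi⟩, ?_, rfl⟩
    have h1 : (⟨i, hi⟩ : Fin N).succ = j := Fin.ext (by simp [hj])
    have h2 : (⟨i, hi⟩ : Fin N).castSucc = i := rfl
    rwa [h1, h2]
  · rintro ⟨i, hi, rfl⟩
    exact ⟨i.castSucc, ⟨i.succ, by simp, hi⟩, by simp⟩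

lemma succ_mem_Des {N : ℕ} (π : Equiv.Perm (Fin (N + 1))) (i : Fin N) :
    (i : ℕ) + 1 ∈ Des π ↔ π i.succ < π i.castSucc := by
  rw [Des_eq_image]
  simp only [mem_image, mem_filter, mem_univ, true_and]
  constructor
  · rintro ⟨j, hj, h⟩
    have : j = i := Fin.ext (by omega)
    rwa [← this]
  · intro h
    exact ⟨i, h, rfl⟩

lemma Des_subset_iff {N : ℕ} (π : Equiv.Perm (Fin (N + 1))) (I : Finset ℕ) :
    Des π ⊆ I ↔ ∀ i : Fin N, (i : ℕ) + 1 ∉ I → π i.castSucc < π i.succ := by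
  constructor
  · intro h i hi
    have h1 := fun h' => hi (h ((succ_mem_Des π i).2 h'))
    refine lt_of_le_of_ne (not_lt.1 h1) fun h2 => ?_
    exact absurd (π.injective h2) (Fin.castSucc_lt_succ).ne
  · intro h a ha
    rw [Des_eq_image] at ha
    simp only [mem_image, mem_filter, mem_univ, true_and] at ha
    obtain ⟨i, hi, rfl⟩ := ha
    by_contra hI
    exact absurd (h i hI) hi.not_gt

lemma des_eq_sum {N : ℕ} (π : Equiv.Perm (Fin (N + 1))) : des π = ∑ i : Fin N, descInd π i := by
  rw [des, Des_eq_image, card_image_of_injective, card_filter]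
  · rfl
  · intro i j h
    exact Fin.ext (by simpa using h)

/-- The number of descents of `π` at or after the position `i`. -/
def descFrom {N : ℕ} (π : Equiv.Perm (Fin (N + 1))) (i : Fin (N + 1)) : ℕ :=
  ∑ j : Fin N, if i ≤ j.castSucc then descInd π j else 0

lemma descFrom_zero {N : ℕ} (π : Equiv.Perm (Fin (N + 1))) : descFrom π 0 = des π := by
  simp [descFrom, des_eq_sum]

lemma descFrom_last {N : ℕ} (π : Equiv.Perm (Fin (N + 1))) : descFrom π (Fin.last N) = 0 := by
  refine sum_eq_zero fun j _ => if_neg ?_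
  exact not_le.2 (Fin.castSucc_lt_last j)

lemma descFrom_castSucc {N : ℕ} (π : Equiv.Perm (Fin (N + 1))) (i : Fin N) :
    descFrom π i.castSucc = descFrom π i.succ + descInd π i := by
  have h : descInd π i = ∑ j : Fin N, if j = i then descInd π j else 0 := by simp
  rw [h, descFrom, descFrom, ← sum_add_distrib]
  refine sum_congr rfl fun j _ => ?_
  simp only [Fin.le_def, Fin.val_castSucc, Fin.val_succ, Fin.ext_iff]
  split_ifs <;> omega

/-- Double counting: the descent with zero-based index j is seen from the j + 1 positions up to it.
-/
lemma sum_descFrom {N : ℕ} (π : Equiv.Perm (Fin (N + 1))) : ∑ i, descFrom π i = maj π := by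
  simp only [descFrom, maj]
  rw [sum_comm]
  refine sum_congr rfl fun j _ => ?_
  rw [← sum_filter, sum_const, smul_eq_mul]
  congr 1
  have : (univ.filter fun i : Fin (N + 1) => i ≤ j.castSucc) = Iic j.castSucc := by
    ext; simp
  rw [this]; simp

/-! ### Functions sorted by a permutation (P-partitions). -/

/-- `g` is weakly decreasing along `π`, and strictly so at the descents of `π`. -/
def Sorts {N : ℕ} (g : Fin (N + 1) → ℕ) (π : Equiv.Perm (Fin (N + 1))) : Prop :=
  ∀ i : Fin N, g (π i.succ) + descInd π i ≤ g (π i.castSucc)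

instance {N : ℕ} (g : Fin (N + 1) → ℕ) (π : Equiv.Perm (Fin (N + 1))) : Decidable (Sorts g π) :=
  inferInstanceAs (Decidable (∀ _, _))

/-- The total order on indices by decreasing value of `g`, then by increasing index. -/
def key {N : ℕ} (g : Fin (N + 1) → ℕ) (v : Fin (N + 1)) : ℕᵒᵈ ×ₗ Fin (N + 1) :=
  toLex (OrderDual.toDual (g v), v)

lemma key_lt_key {N : ℕ} (g : Fin (N + 1) → ℕ) (v w : Fin (N + 1)) :
    key g v < key g w ↔ g w < g v ∨ g v = g w ∧ v < w := by
  simp [key, Prod.Lex.toLex_lt_toLex]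

/-- At an ascent of π the tie-break by index permits equal values; at a descent it forbids them,
which is the strictness in `Sorts`. -/
lemma sorts_iff_strictMono {N : ℕ} (g : Fin (N + 1) → ℕ) (π : Equiv.Perm (Fin (N + 1))) :
    Sorts g π ↔ StrictMono (key g ∘ π) := by
  rw [Fin.strictMono_iff_lt_succ]
  refine forall_congr' fun i => ?_
  have hne : π i.castSucc ≠ π i.succ := fun h =>
    absurd (π.injective h) (Fin.castSucc_lt_succ).ne
  simp only [Function.comp_apply, key_lt_key, descInd]
  split_ifs with h
  · have := h.not_gt
    simp only [this, and_false, or_false]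
    omega
  · have : π i.castSucc < π i.succ := lt_of_le_of_ne (not_lt.1 h) hne
    simp only [this, and_true]
    omega

lemma existsUnique_sorts {N : ℕ} (g : Fin (N + 1) → ℕ) :
    ∃! π : Equiv.Perm (Fin (N + 1)), Sorts g π := by
  have hinj : Function.Injective (key g) := fun v w h => by
    exact congrArg (fun x => (ofLex x).2) h
  refine ⟨Tuple.sort (key g), ?_, fun π hπ => ?_⟩
  · refine (sorts_iff_strictMono _ _).2 ?_
    exact (Tuple.monotone_sort _).strictMono_of_injective
      (hinj.comp (Tuple.sort (key g)).injective)
  · have hπ' := (sorts_iff_strictMono g π).1 hπ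
    rw [Tuple.eq_sort_iff]
    exact ⟨hπ'.monotone, fun i j hij h => absurd h (hπ' hij).ne⟩

lemma Sorts.symm_lt_symm {N : ℕ} {g : Fin (N + 1) → ℕ} {π : Equiv.Perm (Fin (N + 1))}
    (h : Sorts g π) (v w : Fin (N + 1)) : π⁻¹ v < π⁻¹ w ↔ g w < g v ∨ g v = g w ∧ v < w := by
  have := ((sorts_iff_strictMono g π).1 h).lt_iff_lt (a := π⁻¹ v) (b := π⁻¹ w)
  rw [← this]
  simp [key_lt_key]

/-- Functions bounded by `m`. -/
def boxFun (N m : ℕ) : Finset (Fin (N + 1) → ℕ) := Fintype.piFinset fun _ => range (m + 1)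

lemma mem_boxFun {N m : ℕ} {g : Fin (N + 1) → ℕ} : g ∈ boxFun N m ↔ ∀ v, g v ≤ m := by
  simp [boxFun]

/-- The functions sorted by `π` with largest value `m` and least value `0`. -/
def sortedBy {N : ℕ} (π : Equiv.Perm (Fin (N + 1))) (m : ℕ) : Finset (Fin (N + 1) → ℕ) :=
  (boxFun N m).filter fun g => Sorts g π ∧ g (π 0) = m ∧ g (π (Fin.last N)) = 0

/-- The weakly decreasing functions with first value `k` and last value `0`. -/
def decreasingFun (N k : ℕ) : Finset (Fin (N + 1) → ℕ) :=
  (boxFun N k).filter fun u => Antitone u ∧ u 0 = k ∧ u (Fin.last N) = 0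

lemma mem_decreasingFun {N k : ℕ} {u : Fin (N + 1) → ℕ} :
    u ∈ decreasingFun N k ↔ Antitone u ∧ u 0 = k ∧ u (Fin.last N) = 0 := by
  simp only [decreasingFun, mem_filter, mem_boxFun, and_iff_right_iff_imp]
  rintro ⟨h1, rfl, -⟩ v
  exact h1 (Fin.zero_le v)

lemma Sorts.antitone {N : ℕ} {g : Fin (N + 1) → ℕ} {π : Equiv.Perm (Fin (N + 1))}
    (h : Sorts g π) : Antitone (g ∘ π) := by
  rw [Fin.antitone_iff_succ_le]
  exact fun i => le_trans (Nat.le_add_right _ _) (h i)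

lemma mem_sortedBy {N m : ℕ} {π : Equiv.Perm (Fin (N + 1))} {g : Fin (N + 1) → ℕ} :
    g ∈ sortedBy π m ↔ Sorts g π ∧ g (π 0) = m ∧ g (π (Fin.last N)) = 0 := by
  simp only [sortedBy, mem_filter, mem_boxFun, and_iff_right_iff_imp]
  rintro ⟨h1, rfl, -⟩ v
  simpa using h1.antitone (Fin.zero_le (π⁻¹ v))

lemma Sorts.descFrom_le {N : ℕ} {g : Fin (N + 1) → ℕ} {π : Equiv.Perm (Fin (N + 1))}
    (h : Sorts g π) (i : Fin (N + 1)) : descFrom π i ≤ g (π i) := by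
  induction i using Fin.reverseInduction with
  | last => simp [descFrom_last]
  | cast i ih =>
    have := h i
    rw [descFrom_castSucc]
    omega

lemma sortedBy_eq_empty {N m : ℕ} {π : Equiv.Perm (Fin (N + 1))} (h : m < des π) :
    sortedBy π m = ∅ := by
  refine eq_empty_of_forall_notMem fun g hg => ?_
  obtain ⟨h1, h2, -⟩ := mem_sortedBy.1 hg
  have := h1.descFrom_le 0
  rw [descFrom_zero] at this
  omega

/-- Subtracting `descFrom` from g ∘ π uses up the forced strict drops and leaves an arbitrary weakly
decreasing sequence; the amount subtracted totals maj. -/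
lemma sum_sortedBy {N m : ℕ} (π : Equiv.Perm (Fin (N + 1))) (h : des π ≤ m) (φ : ℤ → ℤ) :
    ∑ g ∈ sortedBy π m, φ (∑ v, (g v : ℤ)) =
      ∑ u ∈ decreasingFun N (m - des π), φ (maj π + ∑ v, (u v : ℤ)) := by
  refine sum_nbij' (fun g i => g (π i) - descFrom π i)
    (fun u v => u (π⁻¹ v) + descFrom π (π⁻¹ v)) ?_ ?_ ?_ ?_ ?_
  · intro g hg
    obtain ⟨h1, h2, h3⟩ := mem_sortedBy.1 hg
    refine mem_decreasingFun.2 ⟨?_, ?_, ?_⟩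
    · rw [Fin.antitone_iff_succ_le]
      intro i
      have := h1 i
      have := descFrom_castSucc π i
      omega
    · simp [h2, descFrom_zero]
    · simp [h3]
  · intro u hu
    obtain ⟨h1, h2, h3⟩ := mem_decreasingFun.1 hu
    refine mem_sortedBy.2 ⟨?_, ?_, ?_⟩
    · intro i
      have := descFrom_castSucc π i
      have := h1 (Fin.castSucc_lt_succ (i := i)).le
      simp only [Equiv.Perm.coe_inv, Equiv.symm_apply_apply]
      omega
    · simp only [Equiv.Perm.coe_inv, Equiv.symm_apply_apply, descFrom_zero]
      omega
    · simp [descFrom_last, h3]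
  · intro g hg
    obtain ⟨h1, -, -⟩ := mem_sortedBy.1 hg
    funext v
    have := h1.descFrom_le (π⁻¹ v)
    simp only [Equiv.Perm.coe_inv, Equiv.apply_symm_apply] at this ⊢
    omega
  · intro u _
    funext i
    simp
  · intro g hg
    obtain ⟨h1, -, -⟩ := mem_sortedBy.1 hg
    congr 1
    rw [← sum_descFrom, ← Equiv.sum_comp π, Nat.cast_sum, ← sum_add_distrib]
    refine sum_congr rfl fun i _ => ?_
    have := h1.descFrom_le i
    dsimp only
    omega

/-- The involution sends u to k - u read backwards. -/
lemma sum_decreasingFun_reflect {N k : ℕ} (φ : ℤ → ℤ) :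
    ∑ u ∈ decreasingFun N k, φ (∑ v, (u v : ℤ)) =
      ∑ u ∈ decreasingFun N k, φ ((N + 1) * k - ∑ v, (u v : ℤ)) := by
  have hmem : ∀ u ∈ decreasingFun N k, (fun v => k - u v.rev) ∈ decreasingFun N k := by
    intro u hu
    obtain ⟨h1, h2, h3⟩ := mem_decreasingFun.1 hu
    refine mem_decreasingFun.2 ⟨?_, by simp [h3], by simp [h2]⟩
    intro a b hab
    have := h1 (Fin.rev_le_rev.2 hab)
    dsimp only
    omega
  have hle : ∀ u ∈ decreasingFun N k, ∀ v, u v ≤ k := fun u hu =>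
    mem_boxFun.1 (mem_filter.1 hu).1
  have hinv : ∀ u ∈ decreasingFun N k, (fun v : Fin (N + 1) => k - (k - u v.rev.rev)) = u := by
    intro u hu
    funext v
    have := hle u hu v
    rw [Fin.rev_rev]
    omega
  refine sum_nbij' (fun u v => k - u v.rev) (fun u v => k - u v.rev) hmem hmem hinv hinv ?_
  intro u hu
  congr 1
  have : ∀ v, ((k - u v : ℕ) : ℤ) = k - u v := fun v => by
    have := hle u hu v
    omega
  rw [← Equiv.sum_comp Fin.revPerm fun v => ((k - u (Fin.rev v) : ℕ) : ℤ)]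
  simp [this, Fin.revPerm_apply]

lemma decreasingFun_zero (N : ℕ) : decreasingFun N 0 = {fun _ => 0} := by
  ext u
  simp only [mem_decreasingFun, mem_singleton]
  constructor
  · rintro ⟨h1, h2, -⟩
    funext v
    have := h1 (Fin.zero_le v)
    omega
  · rintro rfl
    exact ⟨antitone_const, rfl, rfl⟩

/-! ### Reversal of blocks of linked consecutive indices. -/

section blockReversal

variable (L : ℕ → Prop) [DecidablePred L]

/-- The first element of the block of `v`, where `L i` says that `i` and `i + 1` lie in the same
block. -/
def blockStart (v : ℕ) : ℕ :=
  Nat.find (p := fun a => ∀ i, i < v → a ≤ i → L i) ⟨v, fun i h1 h2 => absurd h1 (by omega)⟩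

lemma blockStart_le (v : ℕ) : blockStart L v ≤ v :=
  Nat.find_min' _ fun i h1 h2 => absurd h1 (by omega)

lemma link_of_blockStart_le {v i : ℕ} (h : blockStart L v ≤ i) (hi : i < v) : L i :=
  Nat.find_spec (p := fun a => ∀ i, i < v → a ≤ i → L i) _ i hi h

lemma blockStart_succ {v : ℕ} (h : L v) : blockStart L (v + 1) = blockStart L v := by
  apply le_antisymm
  · refine Nat.find_min' _ fun i h2 h1 => ?_
    rcases Nat.lt_succ_iff_lt_or_eq.1 h2 with h3 | rfl
    · exact link_of_blockStart_le L h1 h3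
    · exact h
  · exact Nat.find_min' _ fun i h2 h1 => link_of_blockStart_le L h1 (by omega)

variable {L} {N : ℕ} (hL : ∀ i, L i → i < N)

/-- The last element of the block of `v`. -/
def blockEnd (hL : ∀ i, L i → i < N) (v : ℕ) : ℕ :=
  Nat.find (p := fun b => v ≤ b ∧ ¬ L b) ⟨v + N, by omega, fun h => by have := hL _ h; omega⟩

lemma le_blockEnd (v : ℕ) : v ≤ blockEnd hL v :=
  (Nat.find_spec (p := fun b => v ≤ b ∧ ¬ L b) _).1

lemma not_link_blockEnd (v : ℕ) : ¬ L (blockEnd hL v) :=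
  (Nat.find_spec (p := fun b => v ≤ b ∧ ¬ L b) _).2

lemma link_of_lt_blockEnd {v i : ℕ} (h : v ≤ i) (hi : i < blockEnd hL v) : L i := by
  by_contra hn
  exact Nat.find_min _ hi ⟨h, hn⟩

lemma blockEnd_le {v : ℕ} (hv : v ≤ N) : blockEnd hL v ≤ N :=
  Nat.find_min' _ ⟨hv, fun h => by have := hL _ h; omega⟩

lemma blockEnd_succ {v : ℕ} (h : L v) : blockEnd hL (v + 1) = blockEnd hL v := by
  apply le_antisymm
  · refine Nat.find_min' _ ⟨?_, not_link_blockEnd hL v⟩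
    rcases (le_blockEnd hL v).lt_or_eq with h1 | h1
    · exact h1
    · exact absurd (h1 ▸ h) (not_link_blockEnd hL v)
  · exact Nat.find_min' _ ⟨by have := le_blockEnd hL (v + 1); omega, not_link_blockEnd hL _⟩

/-- A function that does not change along links is constant on blocks. -/
lemma eq_of_mem_block {α : Type*} (c : ℕ → α) (hc : ∀ i, L i → c (i + 1) = c i) {v w : ℕ}
    (h1 : blockStart L v ≤ w) (h2 : w ≤ blockEnd hL v) : c w = c v := by
  have key : ∀ a k, (∀ i, a ≤ i → i < a + k → L i) → c (a + k) = c a := by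
    intro a k
    induction k with
    | zero => simp
    | succ k ih =>
      intro h
      rw [← add_assoc, hc _ (h _ (by omega) (by omega)), ih fun i h1 h2 => h i h1 (by omega)]
  rcases le_total w v with h | h
  · obtain ⟨k, rfl⟩ := Nat.exists_eq_add_of_le h
    exact (key w k fun i h3 h4 => link_of_blockStart_le L (h1.trans h3) h4).symm
  · obtain ⟨k, rfl⟩ := Nat.exists_eq_add_of_le h
    exact key v k fun i h3 h4 => link_of_lt_blockEnd hL h3 (by omega)

/-- The map that reverses each block. -/
def blockRev (hL : ∀ i, L i → i < N) (v : ℕ) : ℕ :=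
  blockStart L v + blockEnd hL v - v

lemma blockStart_le_blockRev (v : ℕ) : blockStart L v ≤ blockRev hL v := by
  have := le_blockEnd hL v
  unfold blockRev
  omega

lemma blockRev_le_blockEnd (v : ℕ) : blockRev hL v ≤ blockEnd hL v := by
  have := blockStart_le L v
  unfold blockRev
  omega

lemma comp_blockRev {α : Type*} (c : ℕ → α) (hc : ∀ i, L i → c (i + 1) = c i) (v : ℕ) :
    c (blockRev hL v) = c v :=
  eq_of_mem_block hL c hc (blockStart_le_blockRev hL v) (blockRev_le_blockEnd hL v)

lemma blockRev_blockRev (v : ℕ) : blockRev hL (blockRev hL v) = v := by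
  have h1 := comp_blockRev hL (blockStart L) (fun i h => blockStart_succ L h) v
  have h2 := comp_blockRev hL (blockEnd hL) (fun i h => blockEnd_succ hL h) v
  have h3 := blockStart_le L v
  have h4 := le_blockEnd hL v
  rw [blockRev, h1, h2, blockRev]
  omega

lemma blockRev_eq_succ {v : ℕ} (h : L v) :
    blockRev hL v = blockRev hL (v + 1) + 1 ∧ L (blockRev hL (v + 1)) := by
  have h1 := blockStart_succ L h
  have h2 := blockEnd_succ hL h
  have h3 := blockStart_le L v
  have h4 := le_blockEnd hL (v + 1)
  refine ⟨by unfold blockRev; omega, ?_⟩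
  have h5 := blockStart_le_blockRev hL (v + 1)
  have h6 : blockRev hL (v + 1) < blockEnd hL (v + 1) := by unfold blockRev; omega
  rcases lt_or_ge (blockRev hL (v + 1)) v with h7 | h7
  · exact link_of_blockStart_le L (h1 ▸ h5) h7
  · exact link_of_lt_blockEnd hL h7 (h2 ▸ h6)

lemma blockRev_lt {v : ℕ} (hv : v < N + 1) : blockRev hL v < N + 1 := by
  have := blockRev_le_blockEnd hL v
  have := blockEnd_le hL (Nat.le_of_lt_succ hv)
  omega

/-- Reversal of the blocks of `Fin (N + 1)`. -/
def blockRevPerm (hL : ∀ i, L i → i < N) : Equiv.Perm (Fin (N + 1)) :=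
  Function.Involutive.toPerm (fun v => ⟨blockRev hL v, blockRev_lt hL v.2⟩) fun v =>
    Fin.ext (blockRev_blockRev hL v)

lemma blockRevPerm_blockRevPerm (v : Fin (N + 1)) :
    blockRevPerm hL (blockRevPerm hL v) = v := Fin.ext (blockRev_blockRev hL v)

end blockReversal

/-- Reversing every block carries links to links with their ends exchanged. Composed with a
complement, which also reverses order, it preserves decrease along links; data constant on blocks
are unaffected. -/
lemma exists_blockReversal {N : ℕ} (P : Fin N → Prop) [DecidablePred P] :
    ∃ ρ : Equiv.Perm (Fin (N + 1)), (∀ v, ρ (ρ v) = v) ∧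
      (∀ i, P i → ∃ j, P j ∧ ρ i.succ = j.castSucc ∧ ρ i.castSucc = j.succ) ∧
      ∀ c : Fin (N + 1) → ℕ, (∀ i, P i → c i.succ = c i.castSucc) → ∀ v, c (ρ v) = c v := by
  have hL : ∀ i, (∃ h : i < N, P ⟨i, h⟩) → i < N := fun i h => h.1
  refine ⟨blockRevPerm hL, blockRevPerm_blockRevPerm hL, fun i hi => ?_, fun c hc v => ?_⟩
  · obtain ⟨h1, h2, h3⟩ := blockRev_eq_succ hL (v := i) ⟨i.2, hi⟩
    exact ⟨_, h3, rfl, Fin.ext h1⟩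
  -- The value 0 outside the range is a dummy: links and blocks of valid indices stay inside.
  · have := comp_blockRev hL (fun a => if h : a < N + 1 then c ⟨a, h⟩ else 0) (by
      rintro a ⟨h, ha⟩
      have h1 : a + 1 < N + 1 := by omega
      have h2 : a < N + 1 := by omega
      simpa [h1, h2] using hc _ ha) v
    simp only [v.2, blockRev_lt hL v.2, dif_pos] at this
    exact this

/-- The functions between bounds `lo` and `hi` that decrease along given links between consecutive
indices have a symmetric distribution of sums, if `lo` and `hi` are constant along the links. -/
lemma sum_reflect_of_links {N : ℕ} (P : Fin N → Prop) [DecidablePred P]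
    (lo hi : Fin (N + 1) → ℕ)
    (hloP : ∀ i, P i → lo i.succ = lo i.castSucc) (hhiP : ∀ i, P i → hi i.succ = hi i.castSucc)
    (B : Finset (Fin (N + 1) → ℕ))
    (hB : ∀ g, g ∈ B ↔ (∀ v, lo v ≤ g v ∧ g v ≤ hi v) ∧ ∀ i, P i → g i.succ ≤ g i.castSucc)
    (φ : ℤ → ℤ) :
    ∑ g ∈ B, φ (∑ v, (g v : ℤ)) = ∑ g ∈ B, φ (∑ v, ((lo v : ℤ) + hi v) - ∑ v, (g v : ℤ)) := by
  obtain ⟨ρ, hρ, hρP, hc⟩ := exists_blockReversal P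
  have hlo := hc lo hloP
  have hhi := hc hi hhiP
  -- Complement within the bounds after block reversal.
  have hmem : ∀ g ∈ B, (fun v => lo v + hi v - g (ρ v)) ∈ B := by
    intro g hg
    obtain ⟨h1, h2⟩ := (hB g).1 hg
    refine (hB _).2 ⟨fun v => ?_, fun i hi' => ?_⟩
    · have := h1 (ρ v)
      rw [hlo, hhi] at this
      omega
    · obtain ⟨j, hj, e1, e2⟩ := hρP i hi'
      have h3 := h1 (ρ i.succ)
      have h4 := h1 (ρ i.castSucc)
      have h5 := h2 j hj
      rw [hlo, hhi] at h3 h4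
      have h6 := hloP i hi'
      have h7 := hhiP i hi'
      rw [← e1, ← e2] at h5
      simp only [h6, h7] at h3 ⊢
      omega
  have hinv : ∀ g ∈ B, (fun v => lo v + hi v - (lo (ρ v) + hi (ρ v) - g (ρ (ρ v)))) = g := by
    intro g hg
    funext v
    have := ((hB g).1 hg).1 v
    rw [hlo, hhi, hρ]
    omega
  refine sum_nbij' (fun g v => lo v + hi v - g (ρ v)) (fun g v => lo v + hi v - g (ρ v))
    hmem hmem hinv hinv ?_
  intro g hg
  congr 1
  rw [← sum_sub_distrib, ← Equiv.sum_comp ρ]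
  refine sum_congr rfl fun v _ => ?_
  have := ((hB g).1 hg).1 (ρ v)
  rw [hlo, hhi] at this
  dsimp only
  omega

/-! ### Arrays with prescribed first maximum and last minimum. -/

/-- The functions bounded by `m` that take the value `m` first at `f` and the value `0` last at
`e`, with ascents only at `I`. -/
def arrays {N : ℕ} (f e : Fin (N + 1)) (I : Finset ℕ) (m : ℕ) : Finset (Fin (N + 1) → ℕ) :=
  (boxFun N m).filter fun g => g f = m ∧ (∀ v, v < f → g v < m) ∧ g e = 0 ∧
    (∀ v, e < v → 0 < g v) ∧ ∀ i : Fin N, (i : ℕ) + 1 ∉ I → g i.succ ≤ g i.castSucc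

/-- The permutations with first letter `f` and last letter `e` whose inverse descents are
in `I`. -/
def permsWith {N : ℕ} (f e : Fin (N + 1)) (I : Finset ℕ) : Finset (Equiv.Perm (Fin (N + 1))) :=
  univ.filter fun π => π 0 = f ∧ π (Fin.last N) = e ∧ IDes π ⊆ I

/-- In the sorting order the first letter is the least index of maximal value and the last letter
the greatest index of minimal value. Moreover i precedes i + 1 in π exactly when g does not ascend
there, so ascents of g are inverse descents of π. -/
lemma Sorts.mem_arrays_iff {N m : ℕ} {f e : Fin (N + 1)} {I : Finset ℕ} {g : Fin (N + 1) → ℕ}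
    {π : Equiv.Perm (Fin (N + 1))} (h : Sorts g π) :
    g ∈ arrays f e I m ↔ π ∈ permsWith f e I ∧ g ∈ sortedBy π m := by
  have hI : (∀ i : Fin N, (i : ℕ) + 1 ∉ I → g i.succ ≤ g i.castSucc) ↔ IDes π ⊆ I := by
    rw [IDes, Des_subset_iff]
    refine forall_congr' fun i => imp_congr_right fun _ => ?_
    rw [h.symm_lt_symm]
    simp only [Fin.castSucc_lt_succ, and_true]
    omega
  rw [mem_sortedBy]
  simp only [arrays, permsWith, mem_filter, mem_univ, true_and, hI, h, mem_boxFun]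
  constructor
  · rintro ⟨hb, hf, hf', he, he', hI⟩
    have h0 : π 0 = f := by
      by_contra hne
      have h1 : π⁻¹ (π 0) < π⁻¹ f := by
        rw [Equiv.Perm.coe_inv, Equiv.symm_apply_apply, Fin.pos_iff_ne_zero]
        intro h2
        exact hne (by rw [← h2, Equiv.apply_symm_apply])
      rw [h.symm_lt_symm, hf] at h1
      rcases h1 with h1 | ⟨h1, h2⟩
      · exact absurd (hb (π 0)) (by omega)
      · exact absurd (hf' _ h2) (by omega)
    have hl : π (Fin.last N) = e := by
      by_contra hne
      have h1 : π⁻¹ e < π⁻¹ (π (Fin.last N)) := by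
        rw [Equiv.Perm.coe_inv, Equiv.symm_apply_apply, Fin.lt_last_iff_ne_last]
        intro h2
        exact hne (by rw [← h2, Equiv.apply_symm_apply])
      rw [h.symm_lt_symm, he] at h1
      rcases h1 with h1 | ⟨h1, h2⟩
      · omega
      · exact absurd (he' _ h2) (by omega)
    exact ⟨⟨h0, hl, hI⟩, h0 ▸ hf, hl ▸ he⟩
  · rintro ⟨⟨rfl, rfl, hI⟩, hf, he⟩
    have hb : ∀ v, g v ≤ m := fun v => by
      simpa [hf] using h.antitone (Fin.zero_le (π⁻¹ v))
    refine ⟨hb, hf, fun v hv => ?_, he, fun v hv => ?_, hI⟩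
    · refine lt_of_le_of_ne (hb v) fun h1 => ?_
      have := (h.symm_lt_symm v (π 0)).2 (Or.inr ⟨h1.trans hf.symm, hv⟩)
      simp at this
    · refine Nat.pos_of_ne_zero fun h1 => ?_
      have := (h.symm_lt_symm (π (Fin.last N)) v).2 (Or.inr ⟨he.trans h1.symm, hv⟩)
      simp only [Equiv.Perm.coe_inv, Equiv.symm_apply_apply] at this
      exact absurd (Fin.le_last _) this.not_ge

lemma sum_arrays {N : ℕ} (f e : Fin (N + 1)) (I : Finset ℕ) (m : ℕ) (ψ : (Fin (N + 1) → ℕ) → ℤ) :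
    ∑ g ∈ arrays f e I m, ψ g = ∑ π ∈ permsWith f e I, ∑ g ∈ sortedBy π m, ψ g := by
  choose σ hσ hσ' using fun g : Fin (N + 1) → ℕ => existsUnique_sorts g
  rw [← sum_fiberwise_of_maps_to (g := σ) fun g hg => ((hσ g).mem_arrays_iff.1 hg).1]
  refine sum_congr rfl fun π hπ => sum_congr ?_ fun _ _ => rfl
  ext g
  rw [mem_filter]
  constructor
  · rintro ⟨h1, rfl⟩
    exact ((hσ g).mem_arrays_iff.1 h1).2
  · intro h1
    have h2 := (mem_sortedBy.1 h1).1
    exact ⟨h2.mem_arrays_iff.2 ⟨hπ, h1⟩, (hσ' g π h2).symm⟩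

/-- All conditions on an array amount to pointwise bounds together with decrease along links, so
block reversal applies. -/
lemma sum_arrays_reflect {N : ℕ} {f e : Fin (N + 1)} (hfe : f ≠ e) (I : Finset ℕ) (m : ℕ)
    (φ : ℤ → ℤ) :
    ∑ g ∈ arrays f e I m, φ (∑ v, (g v : ℤ)) =
      ∑ g ∈ arrays f e I m, φ ((N + 1) * m + (N - f - e) - ∑ v, (g v : ℤ)) := by
  rcases (arrays f e I m).eq_empty_or_nonempty with h0 | ⟨g₀, hg₀⟩
  · simp [h0]
  simp only [arrays, mem_filter, mem_boxFun] at hg₀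
  obtain ⟨b₀, f₀, f₁, e₀, e₁, I₀⟩ := hg₀
  -- An existing array g₀ must ascend into f and out of e, so I permits an ascent there; hence no
  -- link crosses a place where the bounds jump.
  have hfI : ∀ i : Fin N, (i : ℕ) + 1 ∉ I → i.succ ≠ f := by
    rintro i hi rfl
    have := I₀ i hi
    have := f₁ _ (Fin.castSucc_lt_succ (i := i))
    omega
  have heI : ∀ i : Fin N, (i : ℕ) + 1 ∉ I → i.castSucc ≠ e := by
    rintro i hi rfl
    have := I₀ i hi
    have := e₁ _ (Fin.castSucc_lt_succ (i := i))
    omega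
  -- Makes `m - 1` below a genuine subtraction wherever it is used.
  have hm : ∀ v, v < f → 0 < m := fun v hv => by have := f₁ v hv; omega
  let lo : Fin (N + 1) → ℕ := fun v => if v = f then m else if e < v then 1 else 0
  let hi : Fin (N + 1) → ℕ := fun v => if v = e then 0 else if v < f then m - 1 else m
  -- The links leaving f or entering e are dropped: the maximum at f and the zero at e make those
  -- inequalities automatic.
  let P : Fin N → Prop := fun i => (i : ℕ) + 1 ∉ I ∧ i.castSucc ≠ f ∧ i.succ ≠ e
  have hsum : ∑ v, ((lo v : ℤ) + hi v) = (N + 1) * m + (N - f - e) := by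
    -- At f and at e the uniform formula is off by c, with opposite signs, so the corrections cancel
    -- in the sum.
    let c : ℤ := m - if e < f then 1 else 0
    have h1 : ∀ v, (lo v : ℤ) + hi v = m + (if e < v then 1 else 0) - (if v < f then 1 else 0)
        + (if v = f then c else 0) - (if v = e then c else 0) := by
      intro v
      have := hm v
      simp only [lo, hi, c]
      split_ifs <;> (subst_vars; simp_all; try omega)
    have h2 : (univ.filter fun v => e < v) = Ioi e := by ext; simp
    have h3 : (univ.filter fun v => v < f) = Iio f := by ext; simp
    have h4 : ((N - e : ℕ) : ℤ) = N - e := by have := e.2; omega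
    simp only [h1, sum_sub_distrib, sum_add_distrib]
    simp [h2, h3, h4]
    ring
  rw [← hsum]
  refine sum_reflect_of_links P lo hi ?_ ?_ _ ?_ φ
  · rintro i ⟨h1, h2, h3⟩
    have h4 := hfI i h1
    have h5 := heI i h1
    simp only [lo, h2, h4, if_false]
    have : e < i.succ ↔ e < i.castSucc := by
      simp only [Fin.lt_def, ne_eq, Fin.ext_iff, Fin.val_succ, Fin.val_castSucc] at h5 ⊢
      omega
    simp [this]
  · rintro i ⟨h1, h2, h3⟩
    have h4 := hfI i h1
    have h5 := heI i h1
    simp only [hi, h3, h5, if_false]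
    have : i.succ < f ↔ i.castSucc < f := by
      simp only [Fin.lt_def, ne_eq, Fin.ext_iff, Fin.val_succ, Fin.val_castSucc] at h4 ⊢
      omega
    simp [this]
  · intro g
    simp only [arrays, mem_filter, mem_boxFun]
    constructor
    · rintro ⟨b, f₂, f₃, e₂, e₃, I₂⟩
      refine ⟨fun v => ?_, fun i hi => I₂ i hi.1⟩
      constructor
      · simp only [lo]
        split_ifs with h1 h2
        · rw [h1, f₂]
        · exact e₃ v h2
        · exact Nat.zero_le _
      · simp only [hi]
        split_ifs with h1 h2
        · rw [h1, e₂]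
        · exact Nat.le_sub_one_of_lt (f₃ v h2)
        · exact b v
    · rintro ⟨b, I₂⟩
      have hef : e < f ∨ f < e := (lt_or_gt_of_ne hfe).symm
      have hb : ∀ v, g v ≤ m := fun v => by
        have := (b v).2
        simp only [hi] at this
        split_ifs at this <;> omega
      have hf : g f = m := by
        have := (b f).1
        have := hb f
        simp only [lo, if_true] at *
        omega
      have he : g e = 0 := by
        have := (b e).2
        simp only [hi, if_true] at this
        omega
      refine ⟨hb, hf, fun v hv => ?_, he, fun v hv => ?_, fun i hiI => ?_⟩
      · have h1 := (b v).2
        have h2 := hm v hv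
        simp only [hi, hv, if_true] at h1
        split_ifs at h1 <;> omega
      · have h1 := (b v).1
        have h2 := e₁ v hv
        simp only [lo, hv, if_true] at h1
        split_ifs at h1 with h3
        · subst h3
          omega
        · omega
      · by_cases h1 : i.castSucc = f
        · rw [h1, hf]
          exact hb _
        by_cases h2 : i.succ = e
        · rw [h2, he]
          exact Nat.zero_le _
        exact I₂ i ⟨hiI, h1, h2⟩

/-! ### Symmetry of the major index. -/

/-- For given first and last letter, number of descents and bound on the inverse descent set, the
distribution of the major index is symmetric. -/
lemma sum_permsWith_reflect {N : ℕ} {f e : Fin (N + 1)} (hfe : f ≠ e) (I : Finset ℕ) (d : ℕ)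
    (φ : ℤ → ℤ) :
    ∑ π ∈ permsWith f e I with des π = d, φ (maj π) =
      ∑ π ∈ permsWith f e I with des π = d, φ ((N + 1) * d + (N - f - e) - maj π) := by
  induction d using Nat.strong_induction_on generalizing φ with
  | _ d ih =>
  -- With m = d, a permutation with d descents sorts a single array, of sum maj; one with more
  -- descents sorts none.
  have expand : ∀ φ : ℤ → ℤ, ∑ g ∈ arrays f e I d, φ (∑ v, (g v : ℤ)) =
      (∑ j ∈ range d, ∑ π ∈ permsWith f e I with des π = j,
        ∑ u ∈ decreasingFun N (d - j), φ (maj π + ∑ v, (u v : ℤ))) +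
      ∑ π ∈ permsWith f e I with des π = d, φ (maj π) := by
    intro φ
    have h1 : ∀ π ∈ permsWith f e I, ∑ g ∈ sortedBy π d, φ (∑ v, (g v : ℤ)) =
        ∑ j ∈ range (d + 1), if des π = j then
          ∑ u ∈ decreasingFun N (d - j), φ (maj π + ∑ v, (u v : ℤ)) else 0 := by
      intro π _
      rw [sum_ite_eq]
      split_ifs with h
      · exact sum_sortedBy π (by simpa [Nat.lt_succ_iff] using h) φ
      · rw [sortedBy_eq_empty (by simpa using h), sum_empty]
    rw [sum_arrays f e I d fun g => φ (∑ v, (g v : ℤ)), sum_congr rfl h1, sum_comm,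
      sum_range_succ]
    simp only [sum_filter, Nat.sub_self, decreasingFun_zero, sum_singleton]
    simp
  have h := sum_arrays_reflect hfe I d φ
  rw [expand φ, expand fun x => φ ((N + 1) * d + (N - f - e) - x)] at h
  have hlow : ∀ j ∈ range d,
      (∑ π ∈ permsWith f e I with des π = j,
        ∑ u ∈ decreasingFun N (d - j), φ (maj π + ∑ v, (u v : ℤ))) =
      ∑ π ∈ permsWith f e I with des π = j, ∑ u ∈ decreasingFun N (d - j),
        φ ((N + 1) * d + (N - f - e) - (maj π + ∑ v, (u v : ℤ))) := by
    intro j hj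
    have hj := mem_range.1 hj
    -- Reflecting maj about its centre for j and u about its centre for d - j adds the constants to
    -- the one for d.
    rw [ih j hj fun M => ∑ u ∈ decreasingFun N (d - j), φ (M + ∑ v, (u v : ℤ))]
    refine sum_congr rfl fun π _ => ?_
    rw [sum_decreasingFun_reflect fun x => φ ((N + 1) * j + (N - f - e) - maj π + x)]
    refine sum_congr rfl fun u _ => congrArg φ ?_
    rw [Nat.cast_sub hj.le]
    ring
  rw [sum_congr rfl hlow] at h
  exact add_left_cancel h

/-- Sieve on I: split the inverse descent sets contained in I by their exact value and cancel the
proper subsets by induction. -/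
lemma sum_IDes_eq_reflect {N : ℕ} {f e : Fin (N + 1)} (hfe : f ≠ e) (I : Finset ℕ) (d : ℕ)
    (φ : ℤ → ℤ) :
    ∑ π ∈ permsWith f e I with des π = d ∧ IDes π = I, φ (maj π) =
      ∑ π ∈ permsWith f e I with des π = d ∧ IDes π = I,
        φ ((N + 1) * d + (N - f - e) - maj π) := by
  induction I using Finset.strongInduction with
  | H I ih =>
  have expand : ∀ ψ : Equiv.Perm (Fin (N + 1)) → ℤ,
      ∑ π ∈ permsWith f e I with des π = d, ψ π =
      (∑ J ∈ I.ssubsets, ∑ π ∈ permsWith f e J with des π = d ∧ IDes π = J, ψ π) +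
      ∑ π ∈ permsWith f e I with des π = d ∧ IDes π = I, ψ π := by
    intro ψ
    rw [← sum_fiberwise_of_maps_to (t := I.powerset) (g := IDes) fun π hπ => by
      simp only [permsWith, mem_filter] at hπ
      exact mem_powerset.2 hπ.1.2.2.2]
    rw [← sum_erase_add _ _ (mem_powerset_self I), ssubsets]
    congr 1
    · refine sum_congr rfl fun J hJ => sum_congr ?_ fun _ _ => rfl
      have hJI := mem_powerset.1 (mem_of_mem_erase hJ)
      ext π
      simp only [permsWith, mem_filter, mem_univ, true_and]
      constructor
      · rintro ⟨⟨⟨h1, h2, -⟩, h3⟩, h4⟩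
        exact ⟨⟨h1, h2, h4.le⟩, h3, h4⟩
      · rintro ⟨⟨h1, h2, -⟩, h3, h4⟩
        exact ⟨⟨⟨h1, h2, h4.le.trans hJI⟩, h3⟩, h4⟩
    · rw [filter_filter]
  have h := sum_permsWith_reflect hfe I d φ
  rw [expand, expand, sum_congr rfl fun J hJ => ih J (mem_ssubsets.1 hJ)] at h
  exact add_left_cancel h

/-! ### Vincular patterns as sums over a tied pair and a free letter. -/

lemma vincular_two {N : ℕ} (π : Equiv.Perm (Fin (N + 1))) : vincular ![2, 1] {0} π = des π := by
  rw [des_eq_sum]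
  simp only [descInd]
  rw [← card_filter, vincular]
  refine (card_nbij (fun i => ![i.castSucc, i.succ]) ?_ ?_ ?_).symm
  · intro i hi
    simp only [coe_filter, mem_univ, true_and, Set.mem_ofPred_eq] at hi
    simp [Fin.forall_fin_two, hi, hi.le]
  · intro i _ j _ h
    simpa using congrFun h 0
  · intro p hp
    simp only [coe_filter, mem_univ, true_and, Set.mem_ofPred_eq, Fin.forall_fin_two] at hp
    simp at hp
    obtain ⟨h1, h2, h3⟩ := hp
    have h4 : (p 0 : ℕ) < N := by have := (p 1).2; omega
    have e1 : (⟨p 0, h4⟩ : Fin N).castSucc = p 0 := rfl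
    have e2 : (⟨p 0, h4⟩ : Fin N).succ = p 1 := Fin.ext (by simp [h3])
    refine ⟨⟨p 0, h4⟩, ?_, ?_⟩
    · simp [e1, e2, h2.2]
    · funext a
      fin_cases a <;> simp [e1, e2]

lemma vec_three_lt_vec_three {α : Type*} [Preorder α] {x y z : α} (h1 : x < y) (h2 : y < z)
    {a b : Fin 3} (h : a < b) : ![x, y, z] a < ![x, y, z] b := by
  fin_cases a <;> fin_cases b <;>
    first
    | exact absurd h (by decide)
    | exact h1
    | exact h2
    | exact h1.trans h2

lemma vincular_three_zero {N : ℕ} (π : Equiv.Perm (Fin (N + 1))) (τ : Fin 3 → ℕ) :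
    vincular τ {0} π = ∑ k : Fin (N + 1), ∑ i : Fin N, if i.succ < k ∧
      ∀ a b : Fin 3, ![π i.castSucc, π i.succ, π k] a < ![π i.castSucc, π i.succ, π k] b ↔
        τ a < τ b then 1 else 0 := by
  rw [← Fintype.sum_prod_type', ← card_filter, vincular]
  refine (card_nbij (fun x => ![x.2.castSucc, x.2.succ, x.1]) ?_ ?_ ?_).symm
  · rintro ⟨k, i⟩ hi
    simp only [coe_filter, mem_univ, true_and, Set.mem_ofPred_eq] at hi ⊢
    refine ⟨fun a b => vec_three_lt_vec_three Fin.castSucc_lt_succ hi.1, fun a b => ?_, ?_⟩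
    · rw [← hi.2 a b]
      fin_cases a <;> fin_cases b <;> rfl
    · simp [Fin.forall_fin_succ]
  · rintro ⟨k, i⟩ _ ⟨k', i'⟩ _ h
    have h1 := congrFun h 0
    have h2 := congrFun h 2
    simp_all
  · intro p hp
    simp only [coe_filter, mem_univ, true_and, Set.mem_ofPred_eq] at hp
    obtain ⟨h1, h2, h3⟩ := hp
    have h3 := h3 0 1 (by simp) rfl
    have h4 : (p 0 : ℕ) < N := by have := (p 1).2; omega
    have e1 : (⟨p 0, h4⟩ : Fin N).castSucc = p 0 := rfl
    have e2 : (⟨p 0, h4⟩ : Fin N).succ = p 1 := Fin.ext (by simp [h3])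
    refine ⟨(p 2, ⟨p 0, h4⟩), ?_, ?_⟩
    · simp only [coe_filter, mem_univ, true_and, Set.mem_ofPred_eq, e1, e2]
      refine ⟨h1 1 2 (by decide), fun a b => ?_⟩
      rw [← h2 a b]
      fin_cases a <;> fin_cases b <;> rfl
    · funext a
      fin_cases a <;> simp [e1, e2]

lemma vincular_three_one {N : ℕ} (π : Equiv.Perm (Fin (N + 1))) (τ : Fin 3 → ℕ) :
    vincular τ {1} π = ∑ k : Fin (N + 1), ∑ i : Fin N, if k < i.castSucc ∧
      ∀ a b : Fin 3, ![π k, π i.castSucc, π i.succ] a < ![π k, π i.castSucc, π i.succ] b ↔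
        τ a < τ b then 1 else 0 := by
  rw [← Fintype.sum_prod_type', ← card_filter, vincular]
  refine (card_nbij (fun x => ![x.1, x.2.castSucc, x.2.succ]) ?_ ?_ ?_).symm
  · rintro ⟨k, i⟩ hi
    simp only [coe_filter, mem_univ, true_and, Set.mem_ofPred_eq] at hi ⊢
    refine ⟨fun a b => vec_three_lt_vec_three hi.1 Fin.castSucc_lt_succ, fun a b => ?_, ?_⟩
    · rw [← hi.2 a b]
      fin_cases a <;> fin_cases b <;> rfl
    · simp [Fin.forall_fin_succ]
  · rintro ⟨k, i⟩ _ ⟨k', i'⟩ _ h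
    have h1 := congrFun h 0
    have h2 := congrFun h 1
    simp_all
  · intro p hp
    simp only [coe_filter, mem_univ, true_and, Set.mem_ofPred_eq] at hp
    obtain ⟨h1, h2, h3⟩ := hp
    have h3 := h3 1 2 (by simp) rfl
    have h4 : (p 1 : ℕ) < N := by have := (p 2).2; omega
    have e1 : (⟨p 1, h4⟩ : Fin N).castSucc = p 1 := rfl
    have e2 : (⟨p 1, h4⟩ : Fin N).succ = p 2 := Fin.ext (by simp [h3])
    refine ⟨(p 0, ⟨p 1, h4⟩), ?_, ?_⟩
    · simp only [coe_filter, mem_univ, true_and, Set.mem_ofPred_eq, e1, e2]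
      refine ⟨h1 0 1 (by decide), fun a b => ?_⟩
      rw [← h2 a b]
      fin_cases a <;> fin_cases b <;> rfl
    · funext a
      fin_cases a <;> simp [e1, e2]

/-- The patterns 132, 213 and 321 are the cases x < z < y, y < x < z and z < y < x, that is, one
cyclic order of x, z, y. -/
lemma vincular_patterns_zero {α : Type*} [LinearOrder α] {x y z : α} (hxy : x ≠ y) (hxz : x ≠ z)
    (hyz : y ≠ z) :
    ((if ∀ a b : Fin 3, ![x, y, z] a < ![x, y, z] b ↔
        (![1, 3, 2] : Fin 3 → ℕ) a < ![1, 3, 2] b then 1 else 0) +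
      ((if ∀ a b : Fin 3, ![x, y, z] a < ![x, y, z] b ↔
        (![2, 1, 3] : Fin 3 → ℕ) a < ![2, 1, 3] b then 1 else 0) +
      (if ∀ a b : Fin 3, ![x, y, z] a < ![x, y, z] b ↔
        (![3, 2, 1] : Fin 3 → ℕ) a < ![3, 2, 1] b then 1 else 0)) : ℤ) =
    (if x < z then 1 else 0) - (if y < z then 1 else 0) + if y < x then 1 else 0 := by
  simp only [Fin.forall_fin_succ]
  rcases lt_or_gt_of_ne hxy with h1 | h1 <;> rcases lt_or_gt_of_ne hxz with h2 | h2 <;>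
    rcases lt_or_gt_of_ne hyz with h3 | h3 <;>
    first
    | exact absurd h1 (not_lt.2 (h2.trans h3).le)
    | exact absurd h1 (not_lt.2 (h3.trans h2).le)
    | simp [h1, h2, h3, h1.not_gt, h2.not_gt, h3.not_gt]

/-- With the free letter z in front, 213, 132 and 321 yield the same three cases as when it comes
last. -/
lemma vincular_patterns_one {α : Type*} [LinearOrder α] {x y z : α} (hxy : x ≠ y) (hxz : x ≠ z)
    (hyz : y ≠ z) :
    ((if ∀ a b : Fin 3, ![z, x, y] a < ![z, x, y] b ↔
        (![2, 1, 3] : Fin 3 → ℕ) a < ![2, 1, 3] b then 1 else 0) +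
      ((if ∀ a b : Fin 3, ![z, x, y] a < ![z, x, y] b ↔
        (![1, 3, 2] : Fin 3 → ℕ) a < ![1, 3, 2] b then 1 else 0) +
      (if ∀ a b : Fin 3, ![z, x, y] a < ![z, x, y] b ↔
        (![3, 2, 1] : Fin 3 → ℕ) a < ![3, 2, 1] b then 1 else 0)) : ℤ) =
    (if x < z then 1 else 0) - (if y < z then 1 else 0) + if y < x then 1 else 0 := by
  simp only [Fin.forall_fin_succ]
  rcases lt_or_gt_of_ne hxy with h1 | h1 <;> rcases lt_or_gt_of_ne hxz with h2 | h2 <;>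
    rcases lt_or_gt_of_ne hyz with h3 | h3 <;>
    first
    | exact absurd h1 (not_lt.2 (h2.trans h3).le)
    | exact absurd h1 (not_lt.2 (h3.trans h2).le)
    | simp [h1, h2, h3, h1.not_gt, h2.not_gt, h3.not_gt]

/-! ### Closed formulas for STAT and BAST. -/

/-- The indicator that `π i`, `c`, `π (i + 1)` are in cyclic order, when these are distinct letters. -/
def cyclicInd {N : ℕ} (π : Equiv.Perm (Fin (N + 1))) (i : Fin N) (c : Fin (N + 1)) : ℤ :=
  (if π i.castSucc < c then 1 else 0) - (if π i.succ < c then 1 else 0) + descInd π i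

lemma apply_castSucc_ne_apply_succ {N : ℕ} (π : Equiv.Perm (Fin (N + 1))) (i : Fin N) :
    π i.castSucc ≠ π i.succ := fun h => absurd (π.injective h) (Fin.castSucc_lt_succ).ne

lemma STAT_eq_sum {N : ℕ} (π : Equiv.Perm (Fin (N + 1))) :
    (STAT π : ℤ) = des π +
      ∑ k : Fin (N + 1), ∑ i : Fin N, if i.succ < k then cyclicInd π i (π k) else 0 := by
  simp only [STAT, vincular_two, vincular_three_zero, add_assoc]
  push_cast
  simp only [← sum_add_distrib]
  congr 1
  refine sum_congr rfl fun k _ => sum_congr rfl fun i _ => ?_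
  by_cases h : i.succ < k
  · simp only [h, true_and, if_true]
    rw [vincular_patterns_zero (apply_castSucc_ne_apply_succ π i)
      (π.injective.ne (Fin.castSucc_lt_succ.trans h).ne) (π.injective.ne h.ne)]
    simp [cyclicInd, descInd]
  · simp [h]

lemma BAST_eq_sum {N : ℕ} (π : Equiv.Perm (Fin (N + 1))) :
    (BAST π : ℤ) = des π +
      ∑ k : Fin (N + 1), ∑ i : Fin N, if k < i.castSucc then cyclicInd π i (π k) else 0 := by
  simp only [BAST, vincular_two, vincular_three_one, add_assoc]
  push_cast
  simp only [← sum_add_distrib]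
  congr 1
  refine sum_congr rfl fun k _ => sum_congr rfl fun i _ => ?_
  by_cases h : k < i.castSucc
  · simp only [h, true_and, if_true]
    rw [vincular_patterns_one (apply_castSucc_ne_apply_succ π i)
      (π.injective.ne h.ne') (π.injective.ne (h.trans Fin.castSucc_lt_succ).ne')]
    simp [cyclicInd, descInd]
  · simp [h]

/-- A telescoping sum over the positions at or after `k`. -/
lemma sum_castSucc_sub_succ_of_le {N : ℕ} (u : Fin (N + 1) → ℤ) (k : Fin (N + 1)) :
    ∑ i : Fin N, (if k ≤ i.castSucc then u i.castSucc - u i.succ else 0) =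
      u k - u (Fin.last N) := by
  induction k using Fin.reverseInduction with
  | last =>
    rw [sub_self]
    exact sum_eq_zero fun i _ => if_neg (not_le.2 (Fin.castSucc_lt_last i))
  | cast j ih =>
    have h : u j.castSucc - u j.succ =
        ∑ i : Fin N, if i = j then u i.castSucc - u i.succ else 0 := by simp
    rw [← sub_add_sub_cancel _ (u j.succ), ← ih, h, ← sum_add_distrib]
    refine sum_congr rfl fun i _ => ?_
    simp only [Fin.le_def, Fin.val_castSucc, Fin.val_succ, Fin.ext_iff]
    split_ifs <;> omega

/-- The comparisons with π k telescope, leaving the end terms and the descents from k on. -/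
lemma sum_cyclicInd_of_le {N : ℕ} (π : Equiv.Perm (Fin (N + 1))) (k : Fin (N + 1)) :
    ∑ i : Fin N, (if k ≤ i.castSucc then cyclicInd π i (π k) else 0) =
      descFrom π k - if π (Fin.last N) < π k then 1 else 0 := by
  have h := sum_castSucc_sub_succ_of_le (fun j => if π j < π k then (1 : ℤ) else 0) k
  rw [if_neg (lt_irrefl _), zero_sub] at h
  rw [sub_eq_add_neg, ← h, descFrom, Nat.cast_sum, ← sum_add_distrib]
  refine sum_congr rfl fun i _ => ?_
  by_cases hk : k ≤ i.castSucc
  · simp only [hk, if_true, cyclicInd]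
    ring
  · simp [hk]

lemma sum_cyclicInd {N : ℕ} (π : Equiv.Perm (Fin (N + 1))) (k : Fin (N + 1)) :
    ∑ i : Fin N, cyclicInd π i (π k) =
      des π + (if π 0 < π k then 1 else 0) - if π (Fin.last N) < π k then 1 else 0 := by
  have h := sum_castSucc_sub_succ_of_le (fun j => if π j < π k then (1 : ℤ) else 0) 0
  simp only [Fin.zero_le, if_true] at h
  rw [add_sub_assoc, ← h, des_eq_sum, Nat.cast_sum, ← sum_add_distrib]
  refine sum_congr rfl fun i _ => ?_
  rw [cyclicInd, add_comm]

lemma cyclicInd_castSucc {N : ℕ} (π : Equiv.Perm (Fin (N + 1))) (i : Fin N) :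
    cyclicInd π i (π i.castSucc) = 0 := by
  simp [cyclicInd, descInd]

lemma cyclicInd_succ {N : ℕ} (π : Equiv.Perm (Fin (N + 1))) (i : Fin N) :
    cyclicInd π i (π i.succ) = 1 := by
  have := apply_castSucc_ne_apply_succ π i
  rcases lt_or_gt_of_ne this with h | h <;> simp [cyclicInd, descInd, h, h.not_gt]

lemma sum_ite_apply_lt {N : ℕ} (π : Equiv.Perm (Fin (N + 1))) (a : Fin (N + 1)) :
    ∑ k, (if a < π k then (1 : ℤ) else 0) = N - a := by
  rw [Equiv.sum_comp π fun v => if a < v then (1 : ℤ) else 0]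
  have h : (univ.filter fun v => a < v) = Ioi a := by ext; simp
  have : ((N - a : ℕ) : ℤ) = N - a := by have := a.2; omega
  simp [h, this]

/-- The pair starting at k contributes 0, so the strict range k < i may be replaced by k ≤ i and
summed by telescoping. -/
lemma BAST_eq {N : ℕ} (π : Equiv.Perm (Fin (N + 1))) :
    (BAST π : ℤ) = des π + maj π - (N - π (Fin.last N)) := by
  rw [BAST_eq_sum, ← sum_ite_apply_lt, ← sum_descFrom, Nat.cast_sum, add_sub_assoc,
    ← sum_sub_distrib]
  congr 1
  refine sum_congr rfl fun k _ => ?_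
  rw [← sum_cyclicInd_of_le]
  refine sum_congr rfl fun i _ => ?_
  rcases lt_trichotomy k i.castSucc with h | rfl | h
  · rw [if_pos h, if_pos h.le]
  · rw [if_neg (lt_irrefl _), if_pos le_rfl, cyclicInd_castSucc]
  · rw [if_neg h.not_gt, if_neg h.not_ge]

/-- The pairs ending before k are all pairs, less those starting at or after k, less the pair ending
at k, which contributes 1 and exists unless k = 0. -/
lemma STAT_eq {N : ℕ} (π : Equiv.Perm (Fin (N + 1))) :
    (STAT π : ℤ) = (N + 2) * des π - maj π - π 0 := by
  have h : ∀ k, ∑ i : Fin N, (if i.succ < k then cyclicInd π i (π k) else 0) =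
      des π - descFrom π k + (if π 0 < π k then 1 else 0) - if k = 0 then 0 else 1 := by
    intro k
    have hk : (if k = 0 then (0 : ℤ) else 1) = ∑ i : Fin N, if i.succ = k then 1 else 0 := by
      cases k using Fin.cases with
      | zero => simp
      | succ j => simp
    have h1 : (des π : ℤ) - descFrom π k + (if π 0 < π k then 1 else 0) =
        ∑ i : Fin N, cyclicInd π i (π k) -
          ∑ i : Fin N, (if k ≤ i.castSucc then cyclicInd π i (π k) else 0) := by
      rw [sum_cyclicInd, sum_cyclicInd_of_le]
      ring
    rw [h1, hk, ← sum_sub_distrib, ← sum_sub_distrib]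
    refine sum_congr rfl fun i _ => ?_
    rcases lt_trichotomy i.succ k with h | rfl | h
    · rw [if_pos h, if_neg (not_le.2 (Fin.castSucc_lt_succ.trans h)), if_neg h.ne]
      ring
    · rw [if_neg (lt_irrefl _), if_neg (not_le.2 Fin.castSucc_lt_succ), if_pos rfl,
        cyclicInd_succ]
      ring
    · rw [if_neg h.not_gt, if_pos (Fin.le_castSucc_iff.2 h), if_neg h.ne']
      ring
  have h0 : ∑ k : Fin (N + 1), (if k = 0 then (0 : ℤ) else 1) = N := by
    rw [Fin.sum_univ_succ]
    simp
  rw [STAT_eq_sum, sum_congr rfl fun k _ => h k, sum_sub_distrib, sum_add_distrib,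
    sum_sub_distrib, sum_ite_apply_lt, h0, ← sum_descFrom π]
  simp
  ring

lemma STAT_eq_BAST_of_apply_zero_eq {N : ℕ} {π : Equiv.Perm (Fin (N + 1))}
    (h : π 0 = π (Fin.last N)) : STAT π = BAST π := by
  have h0 : (0 : Fin (N + 1)) = Fin.last N := π.injective h
  obtain rfl : N = 0 := by simpa [Fin.ext_iff] using h0.symm
  have h1 := STAT_eq π
  have h2 := BAST_eq π
  simp only [des_eq_sum, maj, Finset.univ_eq_empty, Finset.sum_empty] at h1 h2
  have : (π 0 : ℕ) = 0 := by omega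
  rw [← h] at h2
  simp only [this] at h1 h2
  simp at h1 h2
  omega

/-! ### Exchange of STAT and BAST. -/

theorem card_STAT_BAST_eq_card_BAST_STAT {N : ℕ} (f e : Fin (N + 1)) (d : ℕ) (I : Finset ℕ)
    (s t : ℕ) :
    ((permsWith f e I).filter fun π =>
      (des π = d ∧ IDes π = I) ∧ STAT π = s ∧ BAST π = t).card =
    ((permsWith f e I).filter fun π =>
      (des π = d ∧ IDes π = I) ∧ BAST π = s ∧ STAT π = t).card := by
  have hmem : ∀ π ∈ permsWith f e I, π 0 = f ∧ π (Fin.last N) = e := fun π hπ => by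
    simp only [permsWith, mem_filter] at hπ
    exact ⟨hπ.2.1, hπ.2.2.1⟩
  rcases eq_or_ne f e with rfl | hfe
  -- Equal first and last letters force N = 0, where the two statistics agree.
  · refine congrArg card (filter_congr fun π hπ => ?_)
    obtain ⟨h1, h2⟩ := hmem π hπ
    rw [STAT_eq_BAST_of_apply_zero_eq (h1.trans h2.symm)]
  -- The test function is the indicator of (STAT, BAST) = (s, t) written in terms of M = maj;
  -- reflecting M exchanges the two formulas.
  have h := sum_IDes_eq_reflect hfe I d fun M =>
    if (N + 2) * d - M - f = (s : ℤ) ∧ d + M - (N - e) = (t : ℤ) then 1 else 0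
  rw [← natCast_card_filter, ← natCast_card_filter, filter_filter, filter_filter] at h
  have h := Nat.cast_injective h
  convert h using 2
  all_goals
    refine filter_congr fun π hπ => and_congr_right fun hd => ?_
    obtain ⟨h1, h2⟩ := hmem π hπ
    have h3 := STAT_eq π
    have h4 := BAST_eq π
    rw [h1, hd.1] at h3
    rw [h2, hd.1] at h4
    rw [← Nat.cast_inj (R := ℤ), ← Nat.cast_inj (R := ℤ) (n := t), h3, h4]
  refine and_congr (Eq.congr_left ?_) (Eq.congr_left ?_) <;> ring

end PermStat

theorem mainTheorem4 (n : ℕ) (hn : 1 ≤ n) (f e d : ℕ) (I : Finset ℕ) (s t : ℕ) :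
    (Finset.univ.filter fun π : Equiv.Perm (Fin n) =>
        (PermStat.F hn π, PermStat.E hn π, PermStat.des π, PermStat.IDes π,
          PermStat.STAT π, PermStat.BAST π) = (f, e, d, I, s, t)).card =
      (Finset.univ.filter fun π : Equiv.Perm (Fin n) =>
        (PermStat.F hn π, PermStat.E hn π, PermStat.des π, PermStat.IDes π,
          PermStat.BAST π, PermStat.STAT π) = (f, e, d, I, s, t)).card := by
  obtain ⟨N, rfl⟩ := Nat.exists_eq_add_of_le' hn
  have hF : ∀ π : Equiv.Perm (Fin (N + 1)), PermStat.F hn π = (π 0 : ℕ) + 1 := fun _ => rfl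
  have hE : ∀ π : Equiv.Perm (Fin (N + 1)), PermStat.E hn π = (π (Fin.last N) : ℕ) + 1 :=
    fun _ => rfl
  simp only [Prod.mk.injEq, hF, hE]
  -- If f or e is not a letter of [n], both sets are empty.
  by_cases h : ∃ f' e' : Fin (N + 1), f = f' + 1 ∧ e = e' + 1
  · obtain ⟨f', e', rfl, rfl⟩ := h
    convert PermStat.card_STAT_BAST_eq_card_BAST_STAT f' e' d I s t using 2
    all_goals
      ext π
      simp only [PermStat.permsWith, Finset.mem_filter, Finset.mem_univ, true_and,
        Nat.add_right_cancel_iff, Fin.val_inj]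
      constructor
      · rintro ⟨h1, h2, h3, h4, h5, h6⟩
        exact ⟨⟨h1, h2, h4.le⟩, ⟨h3, h4⟩, h5, h6⟩
      · rintro ⟨⟨h1, h2, -⟩, ⟨h3, h4⟩, h5, h6⟩
        exact ⟨h1, h2, h3, h4, h5, h6⟩
  · rw [Finset.filter_false_of_mem, Finset.filter_false_of_mem] <;>
      exact fun π _ hπ => h ⟨_, _, hπ.1.symm, hπ.2.1.symm⟩
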